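/- Let $R$ be an associative ring with unity. Modules are left $R$-modules, and a complex is a (possibly unbounded) chain complex $\cdots\to X_{n+1}\to X_n\to X_{n-1}\to\cdots$ $(n\in\mathbb Z)$ of modules. A complex $P$ is \emph{DG-projective} if every $P_n$ is projective and $\operatorname{Hom}_R(P,E)$ is exact for every exact complex $E$; a \emph{DG-projective resolution} of $X$ is a quasi-isomorphism $\pi\colon P\to X$ with $P$ DG-projective. Let $\mathcal F$ be the class of flat modules. A complex $T$ is \emph{totally $\mathcal F$-acyclic} if every $T_n$ is projective, $T$ is exact, and $\operatorname{Hom}_R(T,F)$ is exact for every $F\in\mathcal F$. An \emph{$\mathcal F$-complete resolution} of $X$ is a diagram $T\xrightarrow{\tau}P\xrightarrow{\pi}X$ of morphisms of complexes in which $T$ is totally $\mathcal F$-acyclic, $\pi$ is a DG-projective resolution, and $\tau_i$ is bijective for all $i\gg0$. The \emph{Ding projective dimension} of $X$ is \[ \operatorname{Dpd}_R(X)=\inf\{\,n\in\mathbb Z : \text{there is an } \mathcal F\text{-complete resolution } T\xrightarrow{\tau}P\xrightarrow{\pi}X \text{ with } \tau_i \text{ bijective for all } i\ge n\,\}\in\{-\infty\}\cup\mathbb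 Z\cup\{\infty\}, \] where $\inf\varnothing=\infty$. It is called \emph{finite} if $\operatorname{Dpd}_R(X)<\infty$ (the value $-\infty$, attained by the exact complexes, is allowed). \textbf{Proposition.} Let $0\to X\to Y\to Z\to 0$ be a short exact sequence of complexes. If two of the three complexes $X$, $Y$, $Z$ have finite Ding projective dimension, then so does the third. -/

import Mathlib

open CategoryTheory

universe u

namespace Ding

noncomputable section

/-! ### Flat left modules over an associative ring

Right `R`-modules are modules over the opposite ring `Rᵐᵒᵖ`; `MulOpposite.op r • a` is `a * r`. -/

section Flat

variable (R : Type u) [Ring R]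

/-- The subgroup of `A ⊗_ℤ M` generated by the elements `(a r) ⊗ m - a ⊗ (r m)`. -/
def balancedRel (A : Type u) [AddCommGroup A] [Module Rᵐᵒᵖ A]
    (M : Type u) [AddCommGroup M] [Module R M] : Submodule ℤ (TensorProduct ℤ A M) :=
  Submodule.span ℤ {x | ∃ (a : A) (r : R) (m : M),
    x = TensorProduct.tmul ℤ (MulOpposite.op r • a) m - TensorProduct.tmul ℤ a (r • m)}

/-- The tensor product `A ⊗_R M` of a right and a left `R`-module (an abelian group). -/
abbrev BalancedTensor (A : Type u) [AddCommGroup A] [Module Rᵐᵒᵖ A]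
    (M : Type u) [AddCommGroup M] [Module R M] : Type u :=
  TensorProduct ℤ A M ⧸ balancedRel R A M

variable {A B : Type u} [AddCommGroup A] [Module Rᵐᵒᵖ A] [AddCommGroup B] [Module Rᵐᵒᵖ B]

theorem balancedRel_le_comap (f : A →ₗ[Rᵐᵒᵖ] B) (M : Type u) [AddCommGroup M] [Module R M] :
    balancedRel R A M ≤
      (balancedRel R B M).comap (LinearMap.rTensor M f.toAddMonoidHom.toIntLinearMap) := by
  refine Submodule.span_le.2 ?_
  rintro _ ⟨a, r, m, rfl⟩
  refine Submodule.subset_span ⟨f a, r, m, ?_⟩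
  simp

/-- The homomorphism `f ⊗_R M : A ⊗_R M → B ⊗_R M`. -/
def balancedMap (f : A →ₗ[Rᵐᵒᵖ] B) (M : Type u) [AddCommGroup M] [Module R M] :
    BalancedTensor R A M →ₗ[ℤ] BalancedTensor R B M :=
  Submodule.mapQ (balancedRel R A M) (balancedRel R B M)
    (LinearMap.rTensor M f.toAddMonoidHom.toIntLinearMap) (balancedRel_le_comap R f M)

/-- A left `R`-module `M` is flat if `- ⊗_R M` preserves injectivity of homomorphisms of
right `R`-modules. -/
def IsFlat (M : Type u) [AddCommGroup M] [Module R M] : Prop :=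
  ∀ (A B : Type u) [AddCommGroup A] [Module Rᵐᵒᵖ A] [AddCommGroup B] [Module Rᵐᵒᵖ B]
    (f : A →ₗ[Rᵐᵒᵖ] B), Function.Injective f → Function.Injective (balancedMap R f M)

end Flat

/-! ### Complexes

A complex of left `R`-modules is an object of `ChainComplex (ModuleCat R) ℤ`, with differentials
`X_n → X_{n-1}`; no boundedness is imposed. -/

variable {R : Type u} [Ring R]

/-- Exactness of the complex of abelian groups `Hom_R(T, F)`: for every `n` the sequence
`Hom(T_{n-1}, F) → Hom(T_n, F) → Hom(T_{n+1}, F)` given by precomposition with the differentials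
of `T` is exact at the middle term. -/
def HomExact (T : ChainComplex (ModuleCat.{u} R) ℤ) (F : ModuleCat.{u} R) : Prop :=
  ∀ n : ℤ, Function.Exact
    (fun g : T.X (n - 1) ⟶ F => T.d n (n - 1) ≫ g)
    (fun f : T.X n ⟶ F => T.d (n + 1) n ≫ f)

/-- Totally `𝓕`-acyclic complexes, where `𝓕` is the class of flat left `R`-modules. -/
structure IsTotallyFlatAcyclic (T : ChainComplex (ModuleCat.{u} R) ℤ) : Prop where
  projective : ∀ n : ℤ, Module.Projective R (T.X n)
  exact : T.Acyclic
  hom_exact : ∀ F : ModuleCat.{u} R, IsFlat R F → HomExact T F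

/-- A complex `P` is DG-projective if all its terms are projective and, for every exact complex `E`,
the complex `Hom_R(P, E)` is exact, i.e. every morphism from `P` to an exact complex is homotopic
to zero (since `E` may be replaced by its shifts, this is exactness in every degree). -/
structure IsDGProjective (P : ChainComplex (ModuleCat.{u} R) ℤ) : Prop where
  projective : ∀ n : ℤ, Module.Projective R (P.X n)
  homotopic_zero : ∀ (E : ChainComplex (ModuleCat.{u} R) ℤ), E.Acyclic →
    ∀ f : P ⟶ E, Nonempty (Homotopy f 0)

/-- An `𝓕`-complete resolution `T ⟶ P ⟶ X` of a complex `X`: a DG-projective resolution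
`π : P ⟶ X`, a totally `𝓕`-acyclic complex `T` and a morphism `τ : T ⟶ P` which is bijective in
all sufficiently large degrees. -/
structure FlatCompleteResolution (X : ChainComplex (ModuleCat.{u} R) ℤ) where
  T : ChainComplex (ModuleCat.{u} R) ℤ
  P : ChainComplex (ModuleCat.{u} R) ℤ
  τ : T ⟶ P
  π : P ⟶ X
  isTotallyFlatAcyclic : IsTotallyFlatAcyclic T
  isDGProjective : IsDGProjective P
  quasiIso : QuasiIso π
  bijective_of_large : ∃ g : ℤ, ∀ i : ℤ, g ≤ i → Function.Bijective (τ.f i)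

/-- The Ding projective dimension of a complex, in `{-∞} ∪ ℤ ∪ {∞}`: the infimum of the integers
`n` such that some `𝓕`-complete resolution `T ⟶ P ⟶ X` is bijective `T_i → P_i` for all `i ≥ n`.
The infimum is `⊤` if there is no such integer. -/
def dpd (X : ChainComplex (ModuleCat.{u} R) ℤ) : WithBot (WithTop ℤ) :=
  sInf ((fun n : ℤ => ((n : WithTop ℤ) : WithBot (WithTop ℤ))) ''
    {n : ℤ | ∃ r : FlatCompleteResolution X, ∀ i : ℤ, n ≤ i → Function.Bijective (r.τ.f i)})

/-- `X` has finite Ding projective dimension: `dpd X < ∞`. The value `-∞`, attained by exact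
complexes, is allowed. -/
def HasFiniteDpd (X : ChainComplex (ModuleCat.{u} R) ℤ) : Prop :=
  dpd X < ⊤

end

end Ding

/-! Finiteness of the Ding dimension just says that some complete resolution exists
(`hasFiniteDpd_iff`), so after passing to cohomological grading it suffices to show that this
property is invariant under quasi-isomorphism and shift and closed under mapping cones. Up to
quasi-isomorphism each term of a short exact sequence is, up to shift, a cone on a map between the
other two.

For the cone of `f : X ⟶ Y`, DG-projectivity lifts `f` to a map `φ` of the projective resolutions.
The map `φ` must then lift to the totally acyclic complexes. In low cohomological degrees the
comparison map is invertible and the lift is forced. It extends to all degrees because `Hom(T, F)`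
is exact for `F` projective, projectives being flat (`isFlat_of_projective`,
`exists_lift_of_isIso_le`). Both squares commute up to homotopy, and the cones of their rows form a
complete resolution of the cone of `f`. -/

namespace Ding

/-! ### Projective modules are flat -/

section ProjectiveFlat

variable {R : Type u} [Ring R] {A B M : Type u} [AddCommGroup A] [Module Rᵐᵒᵖ A]
  [AddCommGroup B] [Module Rᵐᵒᵖ B] [AddCommGroup M] [Module R M]

/-- The map `A ⊗_ℤ M → (M →₀ A)`, `a ⊗ m ↦ (i ↦ a * s(m)_i)`, attached to an `R`-linear map
`s : M → (M →₀ R)`. -/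
noncomputable def coordinates (A : Type u) [AddCommGroup A] [Module Rᵐᵒᵖ A]
    (s : M →ₗ[R] (M →₀ R)) : TensorProduct ℤ A M →ₗ[ℤ] (M →₀ A) :=
  TensorProduct.lift <| AddMonoidHom.toIntLinearMap <|
    { toFun := fun a => AddMonoidHom.toIntLinearMap <|
        (Finsupp.mapRange.addMonoidHom
          { toFun := fun r : R => MulOpposite.op r • a
            map_zero' := by simp
            map_add' := fun x y => by rw [MulOpposite.op_add, add_smul] }).comp s.toAddMonoidHom
      map_zero' := by ext m i; simp
      map_add' := fun a b => by ext m i; simp }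

theorem coordinates_tmul_apply (s : M →ₗ[R] (M →₀ R)) (a : A) (m i : M) :
    coordinates A s (TensorProduct.tmul ℤ a m) i = MulOpposite.op (s m i) • a := rfl

theorem balancedRel_le_ker_coordinates (s : M →ₗ[R] (M →₀ R)) :
    balancedRel R A M ≤ LinearMap.ker (coordinates A s) := by
  refine Submodule.span_le.2 ?_
  rintro _ ⟨a, r, m, rfl⟩
  rw [SetLike.mem_coe, LinearMap.mem_ker, map_sub, sub_eq_zero]
  ext i
  simp [coordinates_tmul_apply, smul_smul]

theorem coordinates_rTensor (s : M →ₗ[R] (M →₀ R)) (f : A →ₗ[Rᵐᵒᵖ] B)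
    (x : TensorProduct ℤ A M) (i : M) :
    coordinates B s (LinearMap.rTensor M f.toAddMonoidHom.toIntLinearMap x) i =
      f (coordinates A s x i) := by
  induction x with
  | zero => simp
  | tmul a m => simp [coordinates_tmul_apply]
  | add x y hx hy => simp [hx, hy]

/-- The map `(M →₀ A) → A ⊗_R M` sending `(a_i)_i` to the class of `∑ i, a_i ⊗ i`. -/
noncomputable def ofCoordinates (R A M : Type u) [Ring R] [AddCommGroup A] [Module Rᵐᵒᵖ A]
    [AddCommGroup M] [Module R M] : (M →₀ A) →+ BalancedTensor R A M :=
  Finsupp.liftAddHom fun i =>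
    ((balancedRel R A M).mkQ.comp ((TensorProduct.mk ℤ A M).flip i)).toAddMonoidHom

theorem mk_smul_tmul (a : A) (r : R) (m : M) :
    (balancedRel R A M).mkQ (TensorProduct.tmul ℤ (MulOpposite.op r • a) m) =
      (balancedRel R A M).mkQ (TensorProduct.tmul ℤ a (r • m)) := by
  rw [← sub_eq_zero, ← map_sub]
  exact (Submodule.Quotient.mk_eq_zero _).2 (Submodule.subset_span ⟨a, r, m, rfl⟩)

theorem ofCoordinates_coordinates (s : M →ₗ[R] (M →₀ R))
    (hs : ∀ m, Finsupp.linearCombination R id (s m) = m) (x : TensorProduct ℤ A M) :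
    ofCoordinates R A M (coordinates A s x) = (balancedRel R A M).mkQ x := by
  induction x with
  | zero => simp
  | add x y hx hy => rw [map_add, map_add, hx, hy, map_add]
  | tmul a m =>
    have key : coordinates A s (TensorProduct.tmul ℤ a m) =
        (s m).mapRange (fun r : R => MulOpposite.op r • a) (by simp) := by
      ext i; rfl
    rw [key, ofCoordinates, Finsupp.liftAddHom_apply, Finsupp.sum_mapRange_index (by simp)]
    conv_rhs => rw [← hs m]
    rw [Finsupp.linearCombination_apply, Finsupp.sum, Finsupp.sum, TensorProduct.tmul_sum, map_sum]
    exact Finset.sum_congr rfl fun i _ => mk_smul_tmul a _ i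

/-- A section `s` of the free cover of `M` gives coordinates on `A ⊗_R M`. They determine an
element, by `ofCoordinates_coordinates`, and `f` acts on each of them separately. -/
theorem isFlat_of_projective [Module.Projective R M] : IsFlat R M := by
  intro A B _ _ _ _ f hf
  obtain ⟨s, hs⟩ := (Module.projective_def (R := R) (P := M)).1 inferInstance
  rw [injective_iff_map_eq_zero]
  intro x
  obtain ⟨x, rfl⟩ := Submodule.Quotient.mk_surjective _ x
  intro hx
  have hx' : LinearMap.rTensor M f.toAddMonoidHom.toIntLinearMap x ∈ balancedRel R B M :=
    (Submodule.Quotient.mk_eq_zero _).1 hx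
  have h0 : coordinates A s x = 0 := by
    ext i
    apply hf
    rw [← coordinates_rTensor, LinearMap.mem_ker.1 (balancedRel_le_ker_coordinates s hx')]
    simp
  have := ofCoordinates_coordinates s hs x
  rw [h0, map_zero] at this
  exact this.symm

end ProjectiveFlat

/-! ### Extending cochains degree by degree -/

section CochainInduction

open CochainComplex CochainComplex.HomComplex Limits

variable {C : Type*} [Category* C] [Preadditive C] {K L : CochainComplex C ℤ}

/-- The complex `Hom(K, F)` is exact. -/
def HomIntoExact (K : CochainComplex C ℤ) (F : C) : Prop :=
  ∀ (i j k : ℤ), i + 1 = j → j + 1 = k → ∀ f : K.X j ⟶ F, K.d i j ≫ f = 0 →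
    ∃ g : K.X k ⟶ F, K.d j k ≫ g = f

/-- The error `z - δ α` is a cocycle vanishing up to degree `m`, so its component at `m + 1` is
killed by the differential of `K` and factors through the next one. The factor corrects `α` at `m +
2` only. -/
theorem exists_single_eqUpTo {d e : ℤ} (hde : d + 1 = e) {z : Cochain K L e}
    (hz : δ e (e + 1) z = 0) {m m' : ℤ} (hm : m + 1 = m') (hK : ∀ i, HomIntoExact K (L.X i))
    {α : Cochain K L d} (hα : (δ d e α).EqUpTo z m) :
    ∃ β : K.X (m + 2) ⟶ L.X (m + 2 + d),
      (δ d e (α + Cochain.single β d)).EqUpTo z m' := by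
  subst hm
  have hw : δ e (e + 1) (z - δ d e α) = 0 := by rw [δ_sub, hz, δ_δ, sub_zero]
  have hwm : K.d m (m + 1) ≫ (z - δ d e α).v (m + 1) (m + 2 + d) (by lia) = 0 := by
    have h := Cochain.congr_v hw m (m + 2 + d) (by lia)
    rw [δ_v e (e + 1) rfl _ m (m + 2 + d) (by lia) (m + 1 + d) (m + 1) (by lia) (by lia)] at h
    have h0 : (z - δ d e α).v m (m + 1 + d) (by lia) = 0 := by
      rw [Cochain.sub_v, hα m _ _ le_rfl, sub_self]
    rw [h0, zero_comp, zero_add, Cochain.zero_v, Units.smul_def] at h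
    rcases Int.units_eq_one_or (e + 1).negOnePow with h1 | h1
    · simpa [-Cochain.sub_v, h1] using h
    · simpa [-Cochain.sub_v, h1] using h
  obtain ⟨β, hβ⟩ := hK _ m (m + 1) (m + 2) rfl (by lia) _ hwm
  -- The sign cancels the one in front of `d ≫ β` in the formula for `δ`.
  refine ⟨e.negOnePow • β, fun p q hpq hp => ?_⟩
  rw [δ_add, Cochain.add_v]
  obtain hp | rfl := hp.lt_or_eq
  · rw [hα p q hpq (by lia), add_eq_left,
      δ_v d e hde _ p q hpq (q - 1) (p + 1) rfl rfl,
      Cochain.single_v_eq_zero _ _ _ _ _ (by lia),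
      Cochain.single_v_eq_zero _ _ _ _ _ (by lia)]
    simp
  · obtain rfl : q = m + 2 + d := by lia
    rw [δ_v d e hde (Cochain.single _ d) (m + 1) _ hpq (m + 1 + d) (m + 2) (by lia) (by lia),
      Cochain.single_v_eq_zero _ _ _ _ _ (by lia), Cochain.single_v]
    simp [hβ, smul_smul]

open Cochain.InductionUp in
/-- If the complexes `Hom(K, L_i)` are exact, then a cocycle which is a coboundary up to a certain
degree is a coboundary. -/
theorem exists_δ_eq_of_eqUpTo {d e : ℤ} (hde : d + 1 = e) {z : Cochain K L e}
    (hz : δ e (e + 1) z = 0) (m : ℤ) (hK : ∀ i, HomIntoExact K (L.X i))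
    {α : Cochain K L d} (hα : (δ d e α).EqUpTo z m) :
    ∃ β : Cochain K L d, δ d e β = z ∧ β.EqUpTo α (m + 1) := by
  let X (n : ℕ) : Set (Cochain K L d) := {α | (δ d e α).EqUpTo z (m + n)}
  let x₀ : X 0 := ⟨α, by simpa [X] using hα⟩
  let φ (n : ℕ) (α : X n) : X (n + 1) :=
    ⟨_, (exists_single_eqUpTo hde hz (m := m + n) (m' := m + (n + 1 : ℕ))
      (by push_cast; ring) hK α.2).choose_spec⟩
  have hφ (k : ℕ) (x : X k) : (φ k x).1.EqUpTo x.1 (m + 1 + k) := fun p q hpq hp => by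
    dsimp [φ]
    rw [add_eq_left, Cochain.single_v_eq_zero _ _ _ _ _ (by lia)]
  refine ⟨limitSequence φ hφ x₀, ?_, fun p q hpq hp =>
    limitSequence_eqUpTo φ hφ x₀ 0 p q hpq (by simpa using hp)⟩
  -- In degree `p`, `δ` only sees the components `p` and `p + 1`, which are already final at stage
  -- `(p - m).toNat`.
  ext p q hpq
  have h : (δ d e (sequence φ x₀ (p - m).toNat).1).EqUpTo z (m + (p - m).toNat) :=
    (sequence φ x₀ (p - m).toNat).2
  rw [← h p q hpq (by lia),
    δ_v d e hde _ p q hpq (q - 1) (p + 1) rfl rfl,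
    δ_v d e hde _ p q hpq (q - 1) (p + 1) rfl rfl,
    limitSequence_eqUpTo φ hφ x₀ (p - m).toNat p (q - 1) (by lia) (by lia),
    limitSequence_eqUpTo φ hφ x₀ (p - m).toNat (p + 1) q (by lia) (by lia)]

/-- Lifting, up to homotopy, along a morphism which is an isomorphism in low degrees. -/
theorem exists_lift_of_isIso_le {T L L' : CochainComplex C ℤ} (τ : L' ⟶ L) (n : ℤ)
    (hτ : ∀ i ≤ n, IsIso (τ.f i)) (hL' : ∀ i, HomIntoExact T (L'.X i))
    (hL : ∀ i, HomIntoExact T (L.X i)) (g : T ⟶ L) :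
    ∃ ψ : T ⟶ L', Nonempty (Homotopy (ψ ≫ τ) g) := by
  let α : Cochain T L' 0 := Cochain.ofHoms fun i =>
    if h : i ≤ n then have := hτ i h; g.f i ≫ inv (τ.f i) else 0
  have hα (i : ℤ) (hi : i ≤ n) : α.v i i (add_zero i) ≫ τ.f i = g.f i := by
    have := hτ i hi
    simp [α, hi]
  -- The bound drops to `n - 1` because `δ α` at `p` involves `α` at `p + 1`.
  have hδα : (δ 0 1 α).EqUpTo 0 (n - 1) := fun p q hpq hp => by
    subst hpq
    have := hτ (p + 1) (by lia)
    rw [← cancel_mono (τ.f (p + 1)), δ_v 0 1 rfl α p (p + 1) rfl p (p + 1) (by lia) rfl,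
      Preadditive.add_comp, Category.assoc, ← τ.comm, reassoc_of% hα p (by lia),
      Linear.units_smul_comp, Category.assoc, hα (p + 1) (by lia)]
    simp
  obtain ⟨β, hβ, hβα⟩ := exists_δ_eq_of_eqUpTo (zero_add 1) (δ_zero _ _) _ hL' hδα
  let ψ : T ⟶ L' := Cocycle.homOf ⟨β, (Cocycle.mem_iff 0 1 rfl _).2 hβ⟩
  have hψ (i : ℤ) : ψ.f i = β.v i i (add_zero i) := rfl
  -- In degrees up to `n`, `ψ ≫ τ` equals `g`, so the homotopy can start from zero.
  have h0 : (δ (-1) 0 (0 : Cochain T L (-1))).EqUpTo (Cochain.ofHom (ψ ≫ τ - g)) n :=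
    fun p q hpq hp => by
      obtain rfl : p = q := by lia
      simp [hψ, hβα p p (add_zero p) (by lia), hα p hp]
  obtain ⟨γ, hγ, -⟩ := exists_δ_eq_of_eqUpTo (neg_add_cancel 1) (δ_ofHom _) _ hL h0
  exact ⟨ψ, ⟨(Cochain.equivHomotopy _ _).symm ⟨γ, by rw [hγ, Cochain.ofHom_sub]; abel⟩⟩⟩

end CochainInduction
-- Mapping cones in additive categories
section Cones

open CochainComplex CochainComplex.HomComplex Limits

variable {C : Type*} [Category* C] [Preadditive C] [HasBinaryBiproducts C]

/-- `Hom(cone, F)` is an extension of `Hom(L, F)` by a shift of `Hom(K, F)`. Subtracting a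
coboundary makes `f` vanish on `L`; the remainder `f'` comes from `K`. -/
theorem HomIntoExact.mappingCone {K L : CochainComplex C ℤ} {φ : K ⟶ L} {F : C}
    (hK : HomIntoExact K F) (hL : HomIntoExact L F) : HomIntoExact (mappingCone φ) F := by
  rintro i j k rfl rfl f hf
  obtain ⟨b, hb⟩ := hL i _ _ rfl rfl ((mappingCone.inr φ).f _ ≫ f) (by
    rw [← HomologicalComplex.Hom.comm_assoc, hf, comp_zero])
  let f' := f - (CochainComplex.mappingCone φ).d _ _ ≫ (mappingCone.snd φ).v _ _ (add_zero _) ≫ b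
  have hf' : (CochainComplex.mappingCone φ).d i (i + 1) ≫ f' = 0 := by simp [f', hf]
  have hb' : (mappingCone.inr φ).f (i + 1) ≫ f' = 0 := by simp [f', hb]
  obtain ⟨a, ha⟩ := hK (i + 1) _ _ rfl rfl
    ((mappingCone.inl φ).v (i + 1 + 1) (i + 1) (by lia) ≫ f') (by
      have := (mappingCone.inl φ).v (i + 1) i (by lia) ≫= hf'
      rw [comp_zero, mappingCone.inl_v_d_assoc φ (i + 1) i (i + 1 + 1) (by lia) (by lia),
        Preadditive.sub_comp, Category.assoc, Category.assoc, hb', comp_zero, zero_sub,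
        neg_eq_zero] at this
      exact this)
  refine ⟨(mappingCone.snd φ).v _ _ (add_zero _) ≫ b -
    (mappingCone.fst φ).1.v _ (i + 1 + 1 + 1) rfl ≫ a, ?_⟩
  suffices f' = - (CochainComplex.mappingCone φ).d _ _ ≫
      (mappingCone.fst φ).1.v (i + 1 + 1) (i + 1 + 1 + 1) rfl ≫ a by
    rw [Preadditive.comp_sub, sub_eq_add_neg, ← this]
    simp [f']
  rw [mappingCone.ext_from_iff _ (i + 1 + 1) (i + 1) rfl]
  refine ⟨?_, ?_⟩
  · rw [← ha, Preadditive.comp_neg,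
      mappingCone.inl_v_d_assoc φ (i + 1 + 1) (i + 1) (i + 1 + 1 + 1) (by lia) (by lia)]
    simp
  · rw [hb']
    simp

/-- The terms of a mapping cone, as a split extension. -/
noncomputable def mappingConeSplitting {K L : CochainComplex C ℤ} (φ : K ⟶ L) (i : ℤ) :
    (ShortComplex.mk ((mappingCone.inr φ).f i) ((mappingCone.fst φ).1.v i (i + 1) rfl)
      (by simp)).Splitting where
  r := (mappingCone.snd φ).v i i (add_zero i)
  s := (mappingCone.inl φ).v (i + 1) i (by lia)
  id := by simp [mappingCone.id_X φ i (i + 1) rfl, add_comm]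

theorem projective_mappingCone_X {K L : CochainComplex C ℤ} (φ : K ⟶ L) {i : ℤ}
    (hK : Projective (K.X (i + 1))) (hL : Projective (L.X i)) :
    Projective ((mappingCone φ).X i) :=
  Projective.of_iso (HomologicalComplex.homotopyCofiber.XIsoBiprod φ i (i + 1) rfl).symm
    inferInstance

end Cones

/-! ### Quasi-isomorphisms, acyclicity and K-projectivity of cones -/

section AbelianCones

open CochainComplex CochainComplex.HomComplex Limits Pretriangulated

variable {C : Type*} [Category* C] [Abelian C]

theorem isIso_mapOfHomotopy_f {K₁ L₁ K₂ L₂ : CochainComplex C ℤ} {φ₁ : K₁ ⟶ L₁} {φ₂ : K₂ ⟶ L₂}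
    {a : K₁ ⟶ K₂} {b : L₁ ⟶ L₂} (H : Homotopy (φ₁ ≫ b) (a ≫ φ₂)) (i : ℤ)
    (ha : IsIso (a.f (i + 1))) (hb : IsIso (b.f i)) :
    IsIso ((mappingCone.mapOfHomotopy H).f i) := by
  let f : ShortComplex.mk ((mappingCone.inr φ₁).f i) ((mappingCone.fst φ₁).1.v i (i + 1) rfl)
      (by simp) ⟶ ShortComplex.mk ((mappingCone.inr φ₂).f i)
        ((mappingCone.fst φ₂).1.v i (i + 1) rfl) (by simp) :=
    { τ₁ := b.f i
      τ₂ := (mappingCone.mapOfHomotopy H).f i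
      τ₃ := a.f (i + 1)
      comm₁₂ := by simp [mappingCone.mapOfHomotopy]
      comm₂₃ := by
        rw [mappingCone.ext_from_iff _ (i + 1) i rfl]
        simp [mappingCone.mapOfHomotopy] }
  have : IsIso f.τ₁ := hb
  have : IsIso f.τ₃ := ha
  exact ShortComplex.isIso₂_of_shortExact_of_isIso₁₃ f
    (mappingConeSplitting φ₁ i).shortExact (mappingConeSplitting φ₂ i).shortExact

attribute [local instance] HasDerivedCategory.standard in
theorem quasiIso_mapOfHomotopy {K₁ L₁ K₂ L₂ : CochainComplex C ℤ} {φ₁ : K₁ ⟶ L₁} {φ₂ : K₂ ⟶ L₂}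
    {a : K₁ ⟶ K₂} {b : L₁ ⟶ L₂} (H : Homotopy (φ₁ ≫ b) (a ≫ φ₂)) (ha : QuasiIso a)
    (hb : QuasiIso b) : QuasiIso (mappingCone.mapOfHomotopy H) := by
  rw [← DerivedCategory.isIso_Q_map_iff_quasiIso] at ha hb ⊢
  exact isIso₃_of_isIso₁₂ (DerivedCategory.Qh.mapTriangle.map
      (mappingCone.trianglehMapOfHomotopy H))
    (DerivedCategory.Qh.map_distinguished _ (HomotopyCategory.mappingCone_triangleh_distinguished _))
    (DerivedCategory.Qh.map_distinguished _ (HomotopyCategory.mappingCone_triangleh_distinguished _))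
    ha hb

theorem acyclic_mappingCone {K L : CochainComplex C ℤ} (φ : K ⟶ L) (hK : K.Acyclic)
    (hL : L.Acyclic) : (mappingCone φ).Acyclic := by
  rw [← HomotopyCategory.quotient_obj_mem_subcategoryAcyclic_iff_acyclic] at hK hL ⊢
  exact (HomotopyCategory.subcategoryAcyclic C).ext_of_isTriangulatedClosed₃ _
    (HomotopyCategory.mappingCone_triangleh_distinguished φ) hK hL

theorem isKProjective_mappingCone {K L : CochainComplex C ℤ} (φ : K ⟶ L) (hK : K.IsKProjective)
    (hL : L.IsKProjective) : (mappingCone φ).IsKProjective := by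
  rw [isKProjective_iff_leftOrthogonal] at hK hL ⊢
  exact (HomotopyCategory.subcategoryAcyclic C).leftOrthogonal.ext_of_isTriangulatedClosed₃ _
    (HomotopyCategory.mappingCone_triangleh_distinguished φ) hK hL

attribute [local instance] HasDerivedCategory.standard in
/-- Lifting, up to homotopy, of morphisms from K-projective complexes along quasi-isomorphisms. -/
theorem exists_lift_of_quasiIso {P X Y : CochainComplex C ℤ} (hP : P.IsKProjective) (s : X ⟶ Y)
    (hs : QuasiIso s) (f : P ⟶ Y) : ∃ g : P ⟶ X, Nonempty (Homotopy (g ≫ s) f) := by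
  have : IsIso (DerivedCategory.Qh.map ((HomotopyCategory.quotient _ _).map s)) :=
    (DerivedCategory.isIso_Q_map_iff_quasiIso C s).2 hs
  obtain ⟨g, hg⟩ := (IsKProjective.Qh_map_bijective (K := P)
      ((HomotopyCategory.quotient _ _).obj X)).surjective
    (DerivedCategory.Qh.map ((HomotopyCategory.quotient _ _).map f) ≫
      inv (DerivedCategory.Qh.map ((HomotopyCategory.quotient _ _).map s)))
  obtain ⟨g, rfl⟩ := (HomotopyCategory.quotient _ _).map_surjective g
  refine ⟨g, ⟨HomotopyCategory.homotopyOfEq _ _ ?_⟩⟩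
  apply (IsKProjective.Qh_map_bijective (K := P) _).injective
  rw [Functor.map_comp, Functor.map_comp, hg, Category.assoc, IsIso.inv_hom_id, Category.comp_id]

theorem quasiIso_of_homotopy {K L : CochainComplex C ℤ} {f g : K ⟶ L} (h : Homotopy f g)
    (hf : QuasiIso f) : QuasiIso g := by
  rw [quasiIso_iff] at hf ⊢
  intro i
  have := hf i
  rw [quasiIsoAt_iff_isIso_homologyMap] at this ⊢
  rwa [← h.homologyMap_eq]

end AbelianCones
-- Complete resolutions in cohomological grading
section CochainResolutions

open CochainComplex CochainComplex.HomComplex Limits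

variable {R : Type u} [Ring R]

/-- Totally acyclic complexes with respect to flat modules, in cohomological grading. -/
structure CochainTotallyAcyclic (T : CochainComplex (ModuleCat.{u} R) ℤ) : Prop where
  projective : ∀ i, Projective (T.X i)
  acyclic : T.Acyclic
  homIntoExact : ∀ F : ModuleCat.{u} R, IsFlat R F → HomIntoExact T F

theorem CochainTotallyAcyclic.mappingCone {K L : CochainComplex (ModuleCat.{u} R) ℤ} (φ : K ⟶ L)
    (hK : CochainTotallyAcyclic K) (hL : CochainTotallyAcyclic L) :
    CochainTotallyAcyclic (mappingCone φ) where
  projective _ := projective_mappingCone_X φ (hK.projective _) (hL.projective _)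
  acyclic := acyclic_mappingCone φ hK.acyclic hL.acyclic
  homIntoExact F hF := (hK.homIntoExact F hF).mappingCone (hL.homIntoExact F hF)

theorem HomIntoExact.shift {K : CochainComplex (ModuleCat.{u} R) ℤ} {F : ModuleCat.{u} R}
    (hK : HomIntoExact K F) (n : ℤ) : HomIntoExact (K⟦n⟧) F := by
  intro i j k hij hjk f hf
  change K.X (j + n) ⟶ F at f
  change (n.negOnePow • K.d (i + n) (j + n)) ≫ f = 0 at hf
  rw [Linear.units_smul_comp, smul_eq_zero_iff_eq] at hf
  obtain ⟨g, hg⟩ := hK (i + n) (j + n) (k + n) (by lia) (by lia) f hf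
  refine ⟨n.negOnePow • g, ?_⟩
  change (n.negOnePow • K.d (j + n) (k + n)) ≫ (n.negOnePow • g) = f
  rw [Linear.units_smul_comp, Linear.comp_units_smul, smul_smul, Int.units_mul_self, one_smul, hg]

theorem CochainTotallyAcyclic.shift {K : CochainComplex (ModuleCat.{u} R) ℤ}
    (hK : CochainTotallyAcyclic K) (n : ℤ) : CochainTotallyAcyclic (K⟦n⟧) where
  projective i := hK.projective (i + n)
  acyclic := by
    have := hK.acyclic
    rw [← HomotopyCategory.quotient_obj_mem_subcategoryAcyclic_iff_acyclic] at this ⊢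
    exact ObjectProperty.prop_of_iso _
      (((HomotopyCategory.quotient _ (.up ℤ)).commShiftIso n).symm.app K)
      ((HomotopyCategory.subcategoryAcyclic _).le_shift n _ this)
  homIntoExact F hF := (hK.homIntoExact F hF).shift n

theorem CochainTotallyAcyclic.homIntoExact_of_projective {T : CochainComplex (ModuleCat.{u} R) ℤ}
    (hT : CochainTotallyAcyclic T) (F : ModuleCat.{u} R) (hF : Projective F) :
    HomIntoExact T F := by
  have : Module.Projective R F := (IsProjective.iff_projective F).2 hF
  exact hT.homIntoExact F isFlat_of_projective

/-- The existence of a complete resolution, in cohomological grading. -/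
def HasCompleteResolution (X : CochainComplex (ModuleCat.{u} R) ℤ) : Prop :=
  ∃ (T P : CochainComplex (ModuleCat.{u} R) ℤ) (τ : T ⟶ P) (π : P ⟶ X),
    CochainTotallyAcyclic T ∧ (∀ i, Projective (P.X i)) ∧ P.IsKProjective ∧ QuasiIso π ∧
      ∃ n : ℤ, ∀ i ≤ n, IsIso (τ.f i)

variable {X Y : CochainComplex (ModuleCat.{u} R) ℤ}

theorem HasCompleteResolution.of_quasiIso (f : X ⟶ Y) (hf : QuasiIso f) :
    HasCompleteResolution X → HasCompleteResolution Y := by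
  rintro ⟨T, P, τ, π, hT, hP, hP', hπ, hτ⟩
  exact ⟨T, P, τ, π ≫ f, hT, hP, hP', inferInstance, hτ⟩

/-- K-projectivity lifts `π` through `f` up to homotopy; two-out-of-three makes the lift a
quasi-isomorphism. -/
theorem HasCompleteResolution.of_quasiIso' (f : X ⟶ Y) (hf : QuasiIso f) :
    HasCompleteResolution Y → HasCompleteResolution X := by
  rintro ⟨T, P, τ, π, hT, hP, hP', hπ, hτ⟩
  obtain ⟨g, ⟨h⟩⟩ := exists_lift_of_quasiIso hP' f hf π
  have : QuasiIso (g ≫ f) := quasiIso_of_homotopy h.symm hπ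
  exact ⟨T, P, τ, g, hT, hP, hP', quasiIso_of_comp_right g f, hτ⟩

theorem HasCompleteResolution.shift (n : ℤ) :
    HasCompleteResolution X → HasCompleteResolution (X⟦n⟧) := by
  rintro ⟨T, P, τ, π, hT, hP, hP', hπ, m, hm⟩
  refine ⟨T⟦n⟧, P⟦n⟧, τ⟦n⟧', π⟦n⟧', hT.shift n, fun i => hP (i + n), inferInstance,
    (quasiIso_shift_iff π n).2 hπ, m - n, fun i hi => hm (i + n) (by lia)⟩

theorem HasCompleteResolution.of_shift (n : ℤ) (h : HasCompleteResolution (X⟦n⟧)) :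
    HasCompleteResolution X :=
  (h.shift (-n)).of_quasiIso ((shiftEquiv _ n).unitIso.inv.app X) inferInstance

theorem HasCompleteResolution.mappingCone (f : X ⟶ Y) :
    HasCompleteResolution X → HasCompleteResolution Y →
      HasCompleteResolution (mappingCone f) := by
  rintro ⟨T, P, τ, π, hT, hP, hP', hπ, m, hm⟩ ⟨T', P', τ', π', hT', hPY, hPY', hπ', m', hm'⟩
  obtain ⟨φ, ⟨H⟩⟩ := exists_lift_of_quasiIso hP' π' hπ' (π ≫ f)
  obtain ⟨ψ, ⟨H'⟩⟩ := exists_lift_of_isIso_le τ' m' hm'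
    (fun i => hT.homIntoExact_of_projective _ (hT'.projective i))
    (fun i => hT.homIntoExact_of_projective _ (hPY i)) (τ ≫ φ)
  exact ⟨_, _, mappingCone.mapOfHomotopy H', mappingCone.mapOfHomotopy H,
    CochainTotallyAcyclic.mappingCone ψ hT hT',
    fun i => projective_mappingCone_X φ (hP _) (hPY _),
    isKProjective_mappingCone φ hP' hPY', quasiIso_mapOfHomotopy H hπ hπ',
    -- Degree `i` of the cone contains degree `i + 1` of the source, hence `m - 1`.
    min (m - 1) m', fun i hi => isIso_mapOfHomotopy_f H' i (hm _ (by lia)) (hm' _ (by lia))⟩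

/-- Rotation of triangles: the cone of `inr f` is homotopy equivalent to `X⟦1⟧`. -/
theorem hasCompleteResolution_shift_of_mappingCone_inr (f : X ⟶ Y)
    (h : HasCompleteResolution (CochainComplex.mappingCone (mappingCone.inr f))) :
    HasCompleteResolution X :=
  .of_shift 1 (h.of_quasiIso (mappingCone.rotateHomotopyEquiv f).inv inferInstance)

variable {S : ShortComplex (CochainComplex (ModuleCat.{u} R) ℤ)} (hS : S.ShortExact)

include hS

theorem hasCompleteResolution_mappingCone_iff :
    HasCompleteResolution (mappingCone S.f) ↔ HasCompleteResolution S.X₃ :=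
  have := mappingCone.quasiIso_descShortComplex hS
  ⟨.of_quasiIso _ this, .of_quasiIso' _ this⟩

theorem HasCompleteResolution.X₃ (h₁ : HasCompleteResolution S.X₁)
    (h₂ : HasCompleteResolution S.X₂) : HasCompleteResolution S.X₃ :=
  (hasCompleteResolution_mappingCone_iff hS).1 (h₁.mappingCone S.f h₂)

theorem HasCompleteResolution.X₁ (h₂ : HasCompleteResolution S.X₂)
    (h₃ : HasCompleteResolution S.X₃) : HasCompleteResolution S.X₁ :=
  hasCompleteResolution_shift_of_mappingCone_inr S.f
    (h₂.mappingCone _ ((hasCompleteResolution_mappingCone_iff hS).2 h₃))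

theorem HasCompleteResolution.X₂ (h₁ : HasCompleteResolution S.X₁)
    (h₃ : HasCompleteResolution S.X₃) : HasCompleteResolution S.X₂ :=
  -- Rotating twice: `X₂⟦1⟧` is the cone of a map from the cone of `S.f`, a model of `X₃`, to a
  -- model of `X₁⟦1⟧`.
  hasCompleteResolution_shift_of_mappingCone_inr (mappingCone.inr S.f)
    (((hasCompleteResolution_mappingCone_iff hS).2 h₃).mappingCone _
      ((h₁.shift 1).of_quasiIso (mappingCone.rotateHomotopyEquiv S.f).hom inferInstance))

end CochainResolutions
-- Reindexing complexes along an embedding of shapes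
section Restriction

open HomologicalComplex

variable {ι ι' : Type*} {c : ComplexShape ι} {c' : ComplexShape ι'} (e : c.Embedding c')
  [e.IsRelIff] (he : ∀ i, c.Rel (c.prev i) i ∧ c.Rel i (c.next i))
  {C : Type*} [Category* C]

include he

theorem exactAt_restriction_iff [Limits.HasZeroMorphisms C] (K : HomologicalComplex C c') (i : ι) :
    (K.restriction e).ExactAt i ↔ K.ExactAt (e.f i) := by
  rw [exactAt_iff' _ (c.prev i) i (c.next i) rfl rfl,
    exactAt_iff' _ (e.f (c.prev i)) (e.f i) (e.f (c.next i))
      (c'.prev_eq' (e.rel (he i).1)) (c'.next_eq' (e.rel (he i).2))]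
  exact Iff.rfl

theorem quasiIso_restrictionMap [Abelian C] {K L : HomologicalComplex C c'} (f : K ⟶ L)
    (hf : QuasiIso f) : QuasiIso (restrictionMap f e) := by
  rw [quasiIso_iff] at hf ⊢
  intro i
  have := hf (e.f i)
  rw [quasiIsoAt_iff' _ (e.f (c.prev i)) (e.f i) (e.f (c.next i))
      (c'.prev_eq' (e.rel (he i).1)) (c'.next_eq' (e.rel (he i).2))] at this
  rw [quasiIsoAt_iff' _ (c.prev i) i (c.next i) rfl rfl]
  exact this

/-- The restriction of a homotopy along an embedding of complex shapes. -/
def restrictionHomotopy [Preadditive C] {K L : HomologicalComplex C c'} {f g : K ⟶ L}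
    (h : Homotopy f g) : Homotopy (restrictionMap f e) (restrictionMap g e) where
  hom i j := h.hom (e.f i) (e.f j)
  zero i j hij := h.zero _ _ (by rwa [e.rel_iff])
  comm i := by
    let k (i j : ι) : (K.restriction e).X i ⟶ (L.restriction e).X j := h.hom (e.f i) (e.f j)
    have h₁ : dNext (e.f i) h.hom = dNext i k :=
      (dNext_eq h.hom (e.rel (he i).2)).trans (dNext_eq k (he i).2).symm
    have h₂ : prevD (e.f i) h.hom = prevD i k :=
      (prevD_eq h.hom (e.rel (he i).1)).trans (prevD_eq k (he i).1).symm
    exact (h.comm (e.f i)).trans (congrArg (· + g.f (e.f i)) (congrArg₂ (· + ·) h₁ h₂))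

end Restriction

/-! ### Null-homotopies across an equivalence -/

section Transport

variable {C D : Type*} [Category* C] [Preadditive C] {ι ι' : Type*}
  {c : ComplexShape ι} {c' : ComplexShape ι'}

/-- Morphisms from the image of `P` under an equivalence of categories of complexes preserving
homotopies to an acyclic complex are null-homotopic if this holds for `P`. -/
theorem nonempty_homotopy_zero_of_equivalence
    (e : HomologicalComplex C c ≌ HomologicalComplex C c')
    (he : ∀ {K L : HomologicalComplex C c} {f g : K ⟶ L}, Homotopy f g →
      Nonempty (Homotopy (e.functor.map f) (e.functor.map g)))
    (he' : ∀ L : HomologicalComplex C c', L.Acyclic → (e.inverse.obj L).Acyclic)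
    {P : HomologicalComplex C c}
    (hP : ∀ L : HomologicalComplex C c, L.Acyclic → ∀ f : P ⟶ L, Nonempty (Homotopy f 0))
    {L : HomologicalComplex C c'} (hL : L.Acyclic) (f : e.functor.obj P ⟶ L) :
    Nonempty (Homotopy f 0) := by
  -- The adjunct of `f` is null-homotopic; applying the functor and the counit recovers `f`.
  obtain ⟨h⟩ := hP _ (he' L hL) (e.unit.app P ≫ e.inverse.map f)
  obtain ⟨h'⟩ := he h
  have h0 : e.functor.map (0 : P ⟶ e.inverse.obj L) ≫ e.counit.app L = 0 := by
    rw [e.functor.map_zero, Limits.zero_comp]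
  exact ⟨(Homotopy.ofEq (by simp)).trans
    ((h'.compRight (e.counit.app L)).trans (Homotopy.ofEq h0))⟩

end Transport

/-! ### From homological to cohomological grading -/

section Chain

open HomologicalComplex

variable {R : Type u} [Ring R]

theorem up_rel_prev_next (i : ℤ) : (ComplexShape.up ℤ).Rel ((ComplexShape.up ℤ).prev i) i ∧
    (ComplexShape.up ℤ).Rel i ((ComplexShape.up ℤ).next i) := by simp

theorem down_rel_prev_next (i : ℤ) : (ComplexShape.down ℤ).Rel ((ComplexShape.down ℤ).prev i) i ∧
    (ComplexShape.down ℤ).Rel i ((ComplexShape.down ℤ).next i) := by simp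

theorem homExact_iff (T : ChainComplex (ModuleCat.{u} R) ℤ) (F : ModuleCat.{u} R) :
    HomExact T F ↔ ∀ (i j k : ℤ), j + 1 = i → k + 1 = j → ∀ f : T.X j ⟶ F, T.d i j ≫ f = 0 →
      ∃ g : T.X k ⟶ F, T.d j k ≫ g = f := by
  constructor
  · rintro h i j k rfl hk f hf
    obtain rfl : k = j - 1 := by lia
    exact (h j f).1 hf
  · intro h n f
    refine ⟨fun hf => h (n + 1) n (n - 1) rfl (by lia) f hf, ?_⟩
    rintro ⟨g, rfl⟩
    simp

variable (R) in
/-- The equivalence between homological and cohomological grading. -/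
noncomputable abbrev regrade :
    ChainComplex (ModuleCat.{u} R) ℤ ≌ CochainComplex (ModuleCat.{u} R) ℤ :=
  ChainComplex.cochainComplexEquivalence (ModuleCat.{u} R)

theorem acyclic_regrade_functor {K : ChainComplex (ModuleCat.{u} R) ℤ} (hK : K.Acyclic) :
    ((regrade R).functor.obj K).Acyclic := fun i =>
  (exactAt_restriction_iff ComplexShape.embeddingUpIntDownInt up_rel_prev_next K i).2 (hK _)

theorem acyclic_regrade_inverse {K : CochainComplex (ModuleCat.{u} R) ℤ} (hK : K.Acyclic) :
    ((regrade R).inverse.obj K).Acyclic := fun i =>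
  (exactAt_restriction_iff ComplexShape.embeddingDownIntUpInt down_rel_prev_next K i).2 (hK _)

theorem isTotallyFlatAcyclic_regrade_functor {T : ChainComplex (ModuleCat.{u} R) ℤ}
    (hT : IsTotallyFlatAcyclic T) : CochainTotallyAcyclic ((regrade R).functor.obj T) where
  projective i := (IsProjective.iff_projective _).1 (hT.projective (-i))
  acyclic := acyclic_regrade_functor hT.exact
  homIntoExact F hF i j k hij hjk :=
    (homExact_iff T F).1 (hT.hom_exact F hF) (-i) (-j) (-k) (by lia) (by lia)

theorem isTotallyFlatAcyclic_regrade_inverse {T : CochainComplex (ModuleCat.{u} R) ℤ}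
    (hT : CochainTotallyAcyclic T) : IsTotallyFlatAcyclic ((regrade R).inverse.obj T) where
  projective i := (IsProjective.iff_projective _).2 (hT.projective (-i))
  exact := acyclic_regrade_inverse hT.acyclic
  hom_exact F hF := (homExact_iff _ F).2 fun i j k hij hjk =>
    hT.homIntoExact F hF (-i) (-j) (-k) (by lia) (by lia)

theorem isKProjective_regrade_functor {P : ChainComplex (ModuleCat.{u} R) ℤ}
    (hP : IsDGProjective P) : ((regrade R).functor.obj P).IsKProjective where
  nonempty_homotopy_zero f hL :=
    nonempty_homotopy_zero_of_equivalence (regrade R)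
      (fun h => ⟨restrictionHomotopy _ up_rel_prev_next h⟩)
      (fun _ => acyclic_regrade_inverse) hP.homotopic_zero hL f

theorem isDGProjective_regrade_inverse {P : CochainComplex (ModuleCat.{u} R) ℤ}
    (hP : P.IsKProjective) (hP' : ∀ i, Projective (P.X i)) :
    IsDGProjective ((regrade R).inverse.obj P) where
  projective i := (IsProjective.iff_projective _).2 (hP' (-i))
  homotopic_zero _ hL f :=
    nonempty_homotopy_zero_of_equivalence (regrade R).symm
      (fun h => ⟨restrictionHomotopy _ down_rel_prev_next h⟩)
      (fun _ => acyclic_regrade_functor) (fun _ hL f => hP.nonempty_homotopy_zero f hL) hL f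

theorem hasCompleteResolution_regrade_iff (X : ChainComplex (ModuleCat.{u} R) ℤ) :
    HasCompleteResolution ((regrade R).functor.obj X) ↔ Nonempty (FlatCompleteResolution X) := by
  constructor
  · rintro ⟨T, P, τ, π, hT, hP, hP', hπ, n, hn⟩
    refine ⟨⟨(regrade R).inverse.obj T, (regrade R).inverse.obj P, (regrade R).inverse.map τ,
      (regrade R).inverse.map π ≫ (regrade R).unitInv.app X,
      isTotallyFlatAcyclic_regrade_inverse hT, isDGProjective_regrade_inverse hP' hP, ?_, -n,
      fun i hi => (ConcreteCategory.isIso_iff_bijective _).1 (hn (-i) (by lia))⟩⟩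
    have : QuasiIso ((regrade R).inverse.map π) :=
      quasiIso_restrictionMap _ down_rel_prev_next π hπ
    infer_instance
  · rintro ⟨r⟩
    obtain ⟨n, hn⟩ := r.bijective_of_large
    exact ⟨_, _, (regrade R).functor.map r.τ, (regrade R).functor.map r.π,
      isTotallyFlatAcyclic_regrade_functor r.isTotallyFlatAcyclic,
      fun i => (IsProjective.iff_projective _).1 (r.isDGProjective.projective (-i)),
      isKProjective_regrade_functor r.isDGProjective,
      quasiIso_restrictionMap _ up_rel_prev_next r.π r.quasiIso, -n,
      fun i hi => (ConcreteCategory.isIso_iff_bijective _).2 (hn (-i) (by lia))⟩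

theorem hasFiniteDpd_iff (X : ChainComplex (ModuleCat.{u} R) ℤ) :
    HasFiniteDpd X ↔ HasCompleteResolution ((regrade R).functor.obj X) := by
  rw [hasCompleteResolution_regrade_iff]
  constructor
  · intro h
    by_contra hX
    refine h.ne ?_
    have : {n : ℤ | ∃ r : FlatCompleteResolution X, ∀ i : ℤ, n ≤ i →
        Function.Bijective (r.τ.f i)} = ∅ :=
      Set.eq_empty_of_forall_notMem fun n ⟨r, _⟩ => hX ⟨r⟩
    rw [dpd, this, Set.image_empty, sInf_empty]
  · rintro ⟨r⟩
    obtain ⟨n, hn⟩ := r.bijective_of_large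
    have h : dpd X ≤ ((n : WithTop ℤ) : WithBot (WithTop ℤ)) := sInf_le ⟨n, ⟨r, hn⟩, rfl⟩
    exact h.trans_lt (WithBot.coe_lt_coe.2 (WithTop.coe_lt_top n))

instance : (regrade R).functor.PreservesZeroMorphisms :=
  inferInstanceAs (ComplexShape.embeddingUpIntDownInt.restrictionFunctor
    (ModuleCat.{u} R)).PreservesZeroMorphisms

end Chain

end Ding

theorem mainTheorem8 (R : Type u) [Ring R]
    (S : ShortComplex (ChainComplex (ModuleCat.{u} R) ℤ)) (hS : S.ShortExact) :
    (Ding.HasFiniteDpd S.X₁ → Ding.HasFiniteDpd S.X₂ → Ding.HasFiniteDpd S.X₃) ∧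
    (Ding.HasFiniteDpd S.X₁ → Ding.HasFiniteDpd S.X₃ → Ding.HasFiniteDpd S.X₂) ∧
    (Ding.HasFiniteDpd S.X₂ → Ding.HasFiniteDpd S.X₃ → Ding.HasFiniteDpd S.X₁) := by
  have hS' : (S.map (Ding.regrade R).functor).ShortExact := hS.map_of_exact _
  simp only [Ding.hasFiniteDpd_iff]
  exact ⟨Ding.HasCompleteResolution.X₃ hS', Ding.HasCompleteResolution.X₂ hS',
    Ding.HasCompleteResolution.X₁ hS'⟩
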